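/- **Proposition (Converse).** Let $W=\mathsf P_{Y|X}$ be a discrete memoryless channel with finite input and output alphabets $\mathcal X,\mathcal Y$ and capacity $C=C(W)$, used with noiseless, delay-free feedback. All logarithms are to base $2$. *Codes.* A feedback encoder for $M$ messages consists of a common randomness $U$ with a distribution $\mathsf P_U$ and encoders $X_n=f_n(U,\mathsf W,Y^{n-1})\in\mathcal X$, where the message $\mathsf W$ is uniform on $\{1,\dots,M\}$ and independent of $U$. An $(\ell,M,\gamma,K,\epsilon)$ almost-fixed-length feedback (AFLF) code, with $\gamma\ge 0$ and $\epsilon\in(0,1)$, is a feedback encoder together with decoders $g_n(U,Y^n)\in\{1,\dots,M\}$ and a stopping time $\tau$ of the sequence of observations $(U,Y^n)$ such that $\mathsf P(\tau>\ell)\le 2^{-\gamma\ell}$, $\tau\le K\ell$ almost surely, and $\mathsf P(g_\tau(U,Y^\tau)\ne \mathsf W)\le\epsilon$. An $(\ell,M,\epsilon,\epsilon_{\mathbf x})$ fixed-length error-erasure feedback code, with $\epsilon,\epsilon_{\mathbf x}\in(0,1)$, is a feedback encoder together with decoders $g_n(U,Y^n)\in\{1,\dots,M\}\cup\{e\}$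 such that $\hat{\mathsf W}=g_\ell(U,Y^\ell)$ satisfies $\mathsf P(\hat{\mathsf W}\ne \mathsf W)-\mathsf P(\hat{\mathsf W}=e)\le\epsilon$ and $\mathsf P(\hat{\mathsf W}=e)\le\epsilon_{\mathbf x}$. *Exponents.* $\mathcal E_{\rm AFLF}(R,\gamma,K)\in[0,\infty]$ is the supremum of the $E\in\mathbb R$ such that for every $\delta>0$ and all sufficiently large $\ell$ there is an $(\ell,M_\ell,\gamma,K,\epsilon_\ell)$ AFLF code with $M_\ell\ge 2^{\ell R}$ and $\epsilon_\ell\le 2^{-\ell(E-\delta)}$. $\mathcal E_{\rm ee}(R,E_{\mathbf x})\in[0,\infty]$ is the supremum of the $E\in\mathbb R$ such that for every $\delta>0$ and all sufficiently large $\ell$ there is an $(\ell,M_\ell,\epsilon_\ell,\epsilon_{\ell,\mathbf x})$ fixed-length error-erasure feedback code with $M_\ell\ge 2^{\ell R}$, $\epsilon_\ell\le 2^{-\ell(E-\delta)}$ and $\epsilon_{\ell,\mathbf x}\le 2^{-\ell(E_{\mathbf x}-\delta)}$. Haroutunian's exponent is $$E_{\rm H}(R)=\inf_{V:\,C(V)\le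 R}\ \max_{x\in\mathcal X} D\big(V(\cdot|x)\,\|\,W(\cdot|x)\big)\in[0,\infty],$$ where $V$ ranges over the channels from $\mathcal X$ to $\mathcal Y$ and $\inf\emptyset=\infty$. Let $R_\infty=\inf\{C(V): V(\cdot|x)\ll W(\cdot|x)\ \text{for all } x\in\mathcal X\}$; thus $E_{\rm H}(R)=\infty$ for $R<R_\infty$ and $E_{\rm H}(R)<\infty$ for $R\ge R_\infty$. *Claim.* Let $0\le R<C$, $\gamma\ge 0$ and let $K\ge 1$ be an integer. Then $$\mathcal E_{\rm AFLF}(R,\gamma,K)\le\mathcal E_{\rm ee}(R,\gamma),$$ and, if $R/K\ne R_\infty$, $$\mathcal E_{\rm AFLF}(R,\gamma,K)\le\min\Big\{\mathcal E_{\rm ee}(R,\gamma),\ K\,E_{\rm H}\Big(\frac RK\Big)\Big\}.$$ -/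

import Mathlib

open MeasureTheory
open scoped ENNReal

noncomputable section

namespace FeedbackCoding

/-- A discrete memoryless channel: a stochastic matrix, `W x y = P(Y = y | X = x)`. -/
structure DMC (X Y : Type*) [Fintype Y] where
  prob : X → Y → ℝ
  nonneg : ∀ x y, 0 ≤ prob x y
  sum_one : ∀ x, ∑ y, prob x y = 1

instance {X Y : Type*} [Fintype Y] : CoeFun (DMC X Y) (fun _ => X → Y → ℝ) := ⟨DMC.prob⟩

/-! ### Information quantities (all in bits) -/

open Classical in
/-- The Kullback-Leibler divergence `D(p ‖ q)` in bits of two probability vectors, with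
`0 log (0 / q) = 0` and `p log (p / 0) = ∞` for `p > 0`. -/
def klBits {Y : Type*} [Fintype Y] (p q : Y → ℝ) : EReal :=
  if ∃ y, q y = 0 ∧ p y ≠ 0 then ⊤
  else ((∑ y, p y * Real.logb 2 (p y / q y) : ℝ) : EReal)

/-- The mutual information `I(P; V)` in bits. (A summand with `P x * V x y = 0` vanishes,
and otherwise the output probability in the denominator is positive.) -/
def mutualInfo {X Y : Type*} [Fintype X] [Fintype Y] (P : X → ℝ) (V : DMC X Y) : ℝ :=
  ∑ x, ∑ y, P x * V x y * Real.logb 2 (V x y / ∑ x', P x' * V x' y)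

/-- The capacity `C(V)`: the maximal mutual information over all input distributions. -/
def capacity {X Y : Type*} [Fintype X] [Fintype Y] (V : DMC X Y) : EReal :=
  ⨆ P ∈ stdSimplex ℝ X, (mutualInfo P V : EReal)

/-- `max_x D(V(·|x) ‖ W(·|x))`. -/
def maxDiv {X Y : Type*} [Fintype Y] (V W : DMC X Y) : EReal :=
  ⨆ x, klBits (V x) (W x)

/-- Haroutunian's exponent `E_H(R) = min_{V : C(V) ≤ R} max_x D(V(·|x) ‖ W(·|x))`. -/
def haroutunianExponent {X Y : Type*} [Fintype X] [Fintype Y] (W : DMC X Y) (R : ℝ) : EReal :=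
  ⨅ (V : DMC X Y) (_ : capacity V ≤ (R : EReal)), maxDiv V W

/-- `R_∞ = min {C(V) : V(·|x) ≪ W(·|x) for all x}`: Haroutunian's exponent is `∞` at all rates
below `R_∞` and finite at all rates from `R_∞` on. -/
def criticalRate {X Y : Type*} [Fintype X] [Fintype Y] (W : DMC X Y) : EReal :=
  ⨅ (V : DMC X Y) (_ : ∀ x y, W x y = 0 → V x y = 0), capacity V

/-! ### Codes with feedback -/

/-- Common randomness `U ∈ 𝒰` with its distribution, and encoders
`X_{n+1} = f_{n+1}(U, W, Y_1, …, Y_n)` for `M` messages (`enc n` is `f_{n+1}`). -/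
structure FeedbackEncoder (X Y : Type*) (M : ℕ) where
  𝒰 : Type
  mU : MeasurableSpace 𝒰
  law : Measure 𝒰
  isProb : IsProbabilityMeasure law
  enc : (n : ℕ) → 𝒰 → Fin M → (Fin n → Y) → X
  measurable_enc : ∀ n m y x, MeasurableSet {u | enc n u m y = x}

attribute [instance] FeedbackEncoder.mU FeedbackEncoder.isProb

section Prob

variable {X Y : Type*} [Fintype Y] {M : ℕ}

/-- The conditional probability of the outputs `Y_1, …, Y_N` given `U = u` and message `m`. -/
def FeedbackEncoder.pathProb (c : FeedbackEncoder X Y M) (W : DMC X Y) {N : ℕ}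
    (u : c.𝒰) (m : Fin M) (y : Fin N → Y) : ℝ :=
  ∏ i : Fin N, W (c.enc i u m (Fin.take i i.isLt.le y)) (y i)

open Classical in
/-- The probability of an event in `(U, W, Y_1, …, Y_N)`, where `U` has its given distribution
and the message `W` is uniform on `Fin M` and independent of `U`. -/
def FeedbackEncoder.eventProb (c : FeedbackEncoder X Y M) (W : DMC X Y) (N : ℕ)
    (A : c.𝒰 → Fin M → (Fin N → Y) → Prop) : ℝ :=
  (∫⁻ u, ∑ m : Fin M, ∑ y : Fin N → Y,
    (if A u m y then ENNReal.ofReal ((1 / M : ℝ) * c.pathProb W u m y) else 0) ∂c.law).toReal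

end Prob

/-- An `(ℓ, M, γ, K, ε)` almost-fixed-length feedback code for the channel `W`. -/
structure AFLFCode {X Y : Type*} [Fintype Y] (W : DMC X Y)
    (l M : ℕ) (γ : ℝ) (K : ℕ) (ε : ℝ) extends FeedbackEncoder X Y M where
  ε_pos : 0 < ε
  ε_lt_one : ε < 1
  /-- the decoder at time `n` -/
  dec : (n : ℕ) → 𝒰 → (Fin n → Y) → Fin M
  measurable_dec : ∀ n y w, MeasurableSet {u | dec n u y = w}
  /-- the stopping time, a function of `U` and of the outputs up to the horizon `Kℓ` -/
  τ : 𝒰 → (Fin (K * l) → Y) → ℕ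
  measurable_τ : ∀ y n, MeasurableSet {u | τ u y = n}
  /-- the event `τ = n` is determined by `U, Y_1, …, Y_n` -/
  stopping : ∀ u y y' n, (∀ i : Fin (K * l), (i : ℕ) < n → y i = y' i) → τ u y = n → τ u y' = n
  τ_le : ∀ u y, τ u y ≤ K * l
  prob_τ : toFeedbackEncoder.eventProb W (K * l) (fun u _ y => l < τ u y) ≤ (2 : ℝ) ^ (-(γ * l))
  prob_error : toFeedbackEncoder.eventProb W (K * l)
    (fun u m y => dec (τ u y) u (Fin.take (τ u y) (τ_le u y) y) ≠ m) ≤ ε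

/-- An `(ℓ, M, ε, ε_x)` fixed-length error-erasure feedback code for the channel `W`;
the decoder output `none` is the erasure symbol. -/
structure ErasureCode {X Y : Type*} [Fintype Y] (W : DMC X Y)
    (l M : ℕ) (ε εx : ℝ) extends FeedbackEncoder X Y M where
  ε_pos : 0 < ε
  ε_lt_one : ε < 1
  εx_pos : 0 < εx
  εx_lt_one : εx < 1
  /-- the decoder at time `n` -/
  dec : (n : ℕ) → 𝒰 → (Fin n → Y) → Option (Fin M)
  measurable_dec : ∀ n y w, MeasurableSet {u | dec n u y = w}
  prob_error : toFeedbackEncoder.eventProb W l (fun u m y => dec l u y ≠ some m)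
    - toFeedbackEncoder.eventProb W l (fun u _ y => dec l u y = none) ≤ ε
  prob_erasure : toFeedbackEncoder.eventProb W l (fun u _ y => dec l u y = none) ≤ εx

/-! ### Reliability functions -/

/-- `(R, E)` is achievable in a `(γ, K)`-almost-fixed-length manner with feedback. -/
def AFLFAchievable {X Y : Type*} [Fintype Y] (W : DMC X Y) (γ : ℝ) (K : ℕ) (R E : ℝ) : Prop :=
  ∀ δ > (0 : ℝ), ∃ l₀ : ℕ, ∀ l ≥ l₀, ∃ (M : ℕ) (ε : ℝ),
    Nonempty (AFLFCode W l M γ K ε) ∧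
    (2 : ℝ) ^ (l * R) ≤ M ∧ ε ≤ (2 : ℝ) ^ (-(l * (E - δ)))

/-- `(R, E, E_x)` is achievable in a fixed-length manner with feedback and error-erasure
decoding. -/
def ErasureAchievable {X Y : Type*} [Fintype Y] (W : DMC X Y) (R E Ex : ℝ) : Prop :=
  ∀ δ > (0 : ℝ), ∃ l₀ : ℕ, ∀ l ≥ l₀, ∃ (M : ℕ) (ε εx : ℝ),
    Nonempty (ErasureCode W l M ε εx) ∧
    (2 : ℝ) ^ (l * R) ≤ M ∧ ε ≤ (2 : ℝ) ^ (-(l * (E - δ))) ∧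
    εx ≤ (2 : ℝ) ^ (-(l * (Ex - δ)))

/-- `E_AFLF(R, γ, K)`: the supremum of the achievable error exponents. -/
def eAFLF {X Y : Type*} [Fintype Y] (W : DMC X Y) (R γ : ℝ) (K : ℕ) : EReal :=
  ⨆ (E : ℝ) (_ : AFLFAchievable W γ K R E), (E : EReal)

/-- `E_ee(R, E_x)`: the supremum of the error exponents achievable with erasure exponent `E_x`. -/
def eErasure {X Y : Type*} [Fintype Y] (W : DMC X Y) (R Ex : ℝ) : EReal :=
  ⨆ (E : ℝ) (_ : ErasureAchievable W R E Ex), (E : EReal)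

end FeedbackCoding

end

/-! Both bounds come from reading an almost-fixed-length code as a fixed-length one, cut at one of
two horizons.

At time `ℓ`, erase whenever the code has not stopped. Erasures are exactly the event `τ > ℓ`, and
every non-erasure error is an error of the original code, so an error-erasure code results
(`AFLFCode.toErasureCode`). When `γ = 0` the bound `2 ^ (-γℓ) = 1` is not an admissible erasure
probability, but then erasing almost always achieves every exponent.

At time `Kℓ` the code is an ordinary feedback block code of rate `R / K`. Let `V` be an auxiliary
channel and `Q` an input-independent channel with `D(V(·|x) ‖ Q) ≤ c < R / K` for all `x`. Under `Q`
the output says nothing about the message, so correct decoding has probability `1 / M`. Changing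
measure to `V` costs about `2 ^ (Kℓc)`, hence the code fails over `V`. Changing measure again to `W`
costs about `2 ^ (KℓE)`, where `E` bounds the row divergences to `W` (`exists_converse_bound`). The
likelihood ratios concentrate under every feedback strategy by a martingale second-moment bound.

A suitable `Q` with `c = C(V)` is the capacity-achieving output distribution
(`klSum_outputDist_le`). The gap between `C(V) ≤ R / K` and the strict inequality needed is closed
by mixing `V` with a dominated channel of smaller capacity, which exists when `R / K > R_∞`. When `R
/ K < R_∞` Haroutunian's exponent is infinite. -/

open MeasureTheory
open scoped ENNReal

noncomputable section

namespace FeedbackCoding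

/-! ### Output paths under feedback, concentration and change of measure. -/

section Paths

variable {X Y : Type*} [Fintype Y]

/-- The probability of the output sequence `y` when the inputs to `V` are chosen by the
deterministic feedback strategy `f`. -/
def pathWeight (V : DMC X Y) (f : (n : ℕ) → (Fin n → Y) → X) {N : ℕ} (y : Fin N → Y) : ℝ :=
  ∏ i : Fin N, V (f i (Fin.take i i.isLt.le y)) (y i)

/-- The additive functional `∑ g (xᵢ, yᵢ)` along an output sequence. -/
def pathSum (g : X → Y → ℝ) (f : (n : ℕ) → (Fin n → Y) → X) {N : ℕ} (y : Fin N → Y) : ℝ :=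
  ∑ i : Fin N, g (f i (Fin.take i i.isLt.le y)) (y i)

lemma pathWeight_nonneg (V : DMC X Y) (f : (n : ℕ) → (Fin n → Y) → X) {N : ℕ}
    (y : Fin N → Y) : 0 ≤ pathWeight V f y :=
  Finset.prod_nonneg fun _ _ => V.nonneg _ _

omit [Fintype Y] in
lemma take_snoc {N : ℕ} (y : Fin N → Y) (b : Y) (i : ℕ) (hi : i ≤ N) (hi' : i ≤ N + 1) :
    Fin.take i hi' (Fin.snoc y b : Fin (N + 1) → Y) = Fin.take i hi y := by
  funext j
  have : Fin.castLE hi' j = Fin.castSucc (Fin.castLE hi j) := rfl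
  simp only [Fin.take_apply, this]
  exact Fin.snoc_castSucc (α := fun _ => Y) ..

lemma pathWeight_snoc (V : DMC X Y) (f : (n : ℕ) → (Fin n → Y) → X) {N : ℕ}
    (y : Fin N → Y) (b : Y) :
    pathWeight V f (Fin.snoc y b : Fin (N + 1) → Y) = pathWeight V f y * V (f N y) b := by
  unfold pathWeight
  rw [Fin.prod_univ_castSucc]
  congr 1
  · refine Finset.prod_congr rfl fun i _ => ?_
    simp only [Fin.val_castSucc]
    rw [take_snoc y b i i.isLt.le, Fin.snoc_castSucc (α := fun _ => Y)]
  · simp only [Fin.val_last]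
    rw [take_snoc y b N le_rfl, Fin.snoc_last (α := fun _ => Y)]
    rfl

omit [Fintype Y] in
lemma pathSum_snoc (g : X → Y → ℝ) (f : (n : ℕ) → (Fin n → Y) → X) {N : ℕ}
    (y : Fin N → Y) (b : Y) :
    pathSum g f (Fin.snoc y b : Fin (N + 1) → Y) = pathSum g f y + g (f N y) b := by
  unfold pathSum
  rw [Fin.sum_univ_castSucc]
  congr 1
  · refine Finset.sum_congr rfl fun i _ => ?_
    simp only [Fin.val_castSucc]
    rw [take_snoc y b i i.isLt.le, Fin.snoc_castSucc (α := fun _ => Y)]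
  · simp only [Fin.val_last]
    rw [take_snoc y b N le_rfl, Fin.snoc_last (α := fun _ => Y)]
    rfl

lemma sum_eq_sum_snoc {N : ℕ} (F : (Fin (N + 1) → Y) → ℝ) :
    ∑ y, F y = ∑ y : Fin N → Y, ∑ b : Y, F (Fin.snoc y b : Fin (N + 1) → Y) := by
  rw [← (Fin.snocEquiv fun _ : Fin (N + 1) => Y).sum_comp, Fintype.sum_prod_type,
    Finset.sum_comm]
  rfl

/-- Inputs are causal, so later outputs sum out one letter at a time, each row of `V` having total
mass one. -/
lemma sum_take_mul_pathWeight (V : DMC X Y) (f : (n : ℕ) → (Fin n → Y) → X) {l N : ℕ}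
    (h : l ≤ N) (F : (Fin l → Y) → ℝ) :
    ∑ y : Fin N → Y, F (Fin.take l h y) * pathWeight V f y
      = ∑ y : Fin l → Y, F y * pathWeight V f y := by
  induction N, h using Nat.le_induction with
  | base => rfl
  | succ N h ih =>
    rw [sum_eq_sum_snoc, ← ih]
    refine Finset.sum_congr rfl fun y _ => ?_
    simp_rw [take_snoc y _ l h, pathWeight_snoc, ← Finset.mul_sum, V.sum_one, mul_one]

lemma sum_pathWeight (V : DMC X Y) (f : (n : ℕ) → (Fin n → Y) → X) (N : ℕ) :
    ∑ y : Fin N → Y, pathWeight V f y = 1 := by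
  have := sum_take_mul_pathWeight V f (Nat.zero_le N) (fun _ => 1)
  simpa [pathWeight] using this

/-- The increments have conditional mean zero whatever input the feedback selects. The path sum is
thus a martingale, the cross terms vanish, and each step adds at most `B` to the second moment. -/
lemma sum_pathWeight_mul_pathSum_sq_le (V : DMC X Y) (h : X → Y → ℝ) {B : ℝ}
    (h0 : ∀ x, ∑ b, V x b * h x b = 0) (hB : ∀ x, ∑ b, V x b * h x b ^ 2 ≤ B)
    (f : (n : ℕ) → (Fin n → Y) → X) (N : ℕ) :
    ∑ y : Fin N → Y, pathWeight V f y * pathSum h f y ^ 2 ≤ N * B := by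
  induction N with
  | zero => simp [pathSum]
  | succ N ih =>
    have key : ∀ y : Fin N → Y,
        ∑ b, pathWeight V f (Fin.snoc y b : Fin (N + 1) → Y) *
          pathSum h f (Fin.snoc y b : Fin (N + 1) → Y) ^ 2
        ≤ pathWeight V f y * pathSum h f y ^ 2 + pathWeight V f y * B := by
      intro y
      have e : ∑ b, pathWeight V f (Fin.snoc y b : Fin (N + 1) → Y) *
          pathSum h f (Fin.snoc y b : Fin (N + 1) → Y) ^ 2
          = pathWeight V f y * (pathSum h f y ^ 2 * ∑ b, V (f N y) b
            + 2 * pathSum h f y * ∑ b, V (f N y) b * h (f N y) b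
            + ∑ b, V (f N y) b * h (f N y) b ^ 2) := by
        simp only [Finset.mul_sum, ← Finset.sum_add_distrib, pathWeight_snoc, pathSum_snoc]
        refine Finset.sum_congr rfl fun b _ => ?_
        ring
      rw [e, V.sum_one, h0, ← mul_add]
      refine mul_le_mul_of_nonneg_left ?_ (pathWeight_nonneg V f y)
      linarith [hB (f N y)]
    rw [sum_eq_sum_snoc]
    refine (Finset.sum_le_sum fun y _ => key y).trans ?_
    rw [Finset.sum_add_distrib, ← Finset.sum_mul, sum_pathWeight]
    push_cast
    linarith

open Classical in
/-- Weak law of large numbers, uniformly over feedback strategies. -/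
lemma exists_tail_bound [Fintype X] (V : DMC X Y) (g : X → Y → ℝ) {c : ℝ}
    (hc : ∀ x, ∑ b, V x b * g x b ≤ c) :
    ∃ B : ℝ, ∀ (δ : ℝ), 0 < δ → ∀ (N : ℕ), 0 < N → ∀ f : (n : ℕ) → (Fin n → Y) → X,
      ∑ y : Fin N → Y, (if N * (c + δ) < pathSum g f y then pathWeight V f y else 0)
        ≤ B / (N * δ ^ 2) := by
  set μ : X → ℝ := fun x => ∑ b, V x b * g x b with hμ
  set h : X → Y → ℝ := fun x b => g x b - μ x with hh
  have h0 : ∀ x, ∑ b, V x b * h x b = 0 := by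
    intro x
    simp only [hh, mul_sub, Finset.sum_sub_distrib, ← Finset.sum_mul, V.sum_one, one_mul]
    simp [hμ]
  have hnn : ∀ x, 0 ≤ ∑ b, V x b * h x b ^ 2 := fun x =>
    Finset.sum_nonneg fun b _ => mul_nonneg (V.nonneg _ _) (sq_nonneg _)
  -- Summing the conditional variances over all inputs gives a bound independent of the strategy,
  -- the horizon and `δ`.
  refine ⟨∑ x, ∑ b, V x b * h x b ^ 2, fun δ hδ N hN f => ?_⟩
  set B := ∑ x, ∑ b, V x b * h x b ^ 2
  have hB : ∀ x, ∑ b, V x b * h x b ^ 2 ≤ B := fun x =>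
    Finset.single_le_sum (f := fun x => ∑ b, V x b * h x b ^ 2)
      (fun x _ => hnn x) (Finset.mem_univ x)
  have hN' : (0 : ℝ) < N := by exact_mod_cast hN
  have hNδ : 0 < N * δ := mul_pos hN' hδ
  have hsum : ∀ y : Fin N → Y, pathSum g f y ≤ pathSum h f y + N * c := by
    intro y
    have : (N : ℝ) * c = ∑ _i : Fin N, c := by simp
    rw [this, pathSum, pathSum, ← Finset.sum_add_distrib]
    refine Finset.sum_le_sum fun i _ => ?_
    have := hc (f i (Fin.take i i.isLt.le y))
    simp only [hh, hμ]
    linarith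
  -- Chebyshev's inequality, pointwise on the tail event.
  have hpt : ∀ y : Fin N → Y, (if N * (c + δ) < pathSum g f y then pathWeight V f y else 0)
      ≤ pathWeight V f y * pathSum h f y ^ 2 / (N * δ) ^ 2 := by
    intro y
    split_ifs with hy
    · rw [le_div_iff₀ (by positivity)]
      refine mul_le_mul_of_nonneg_left ?_ (pathWeight_nonneg V f y)
      have := hsum y
      exact pow_le_pow_left₀ hNδ.le (by linarith) 2
    · exact div_nonneg (mul_nonneg (pathWeight_nonneg V f y) (sq_nonneg _)) (sq_nonneg _)
  refine (Finset.sum_le_sum fun y _ => hpt y).trans ?_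
  rw [← Finset.sum_div]
  refine (div_le_div_of_nonneg_right
    (sum_pathWeight_mul_pathSum_sq_le V h h0 hB f N) (sq_nonneg _)).trans (le_of_eq ?_)
  field_simp

/-- Change of measure along a path, with the log-likelihood ratio in bits. -/
lemma pathWeight_le_rpow_mul (V Q : DMC X Y) (hVQ : ∀ x y, Q x y = 0 → V x y = 0)
    (f : (n : ℕ) → (Fin n → Y) → X) {N : ℕ} (y : Fin N → Y) :
    pathWeight V f y
      ≤ (2 : ℝ) ^ pathSum (fun x b => Real.logb 2 (V x b / Q x b)) f y * pathWeight Q f y := by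
  unfold pathWeight pathSum
  rw [Real.rpow_sum_of_pos two_pos, ← Finset.prod_mul_distrib]
  refine Finset.prod_le_prod (fun _ _ => V.nonneg _ _) fun i _ => ?_
  set x := f i (Fin.take i i.isLt.le y)
  rcases (V.nonneg x (y i)).eq_or_lt with h | h
  · rw [← h]; exact mul_nonneg (Real.rpow_nonneg two_pos.le _) (Q.nonneg _ _)
  · have hQ : 0 < Q x (y i) :=
      (Q.nonneg _ _).lt_of_ne' fun h' => h.ne' (hVQ _ _ h')
    rw [Real.rpow_logb two_pos (by norm_num) (div_pos h hQ), div_mul_cancel₀ _ hQ.ne']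

open Classical in
/-- The probability of an event in the message and the outputs, for a code with the deterministic
feedback strategy `f m` for each message `m`. -/
def condProb {M : ℕ} (W : DMC X Y) (f : Fin M → (n : ℕ) → (Fin n → Y) → X) {N : ℕ}
    (A : Fin M → (Fin N → Y) → Prop) : ℝ :=
  ∑ m, ∑ y, if A m y then (1 / M : ℝ) * pathWeight W (f m) y else 0

/-- Strong converse combined with a change of measure from `V` to `W`: a lower bound for the error
probability over `W` of a deterministic feedback code, in terms of an auxiliary channel `V` and an
output distribution `Q`. -/
lemma exists_converse_bound [Fintype X] (V W Q : DMC X Y) (hQ : ∀ x x', Q x = Q x')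
    (hVW : ∀ x y, W x y = 0 → V x y = 0) (hVQ : ∀ x y, Q x y = 0 → V x y = 0) {E c : ℝ}
    (hE : ∀ x, ∑ y, V x y * Real.logb 2 (V x y / W x y) ≤ E)
    (hc : ∀ x, ∑ y, V x y * Real.logb 2 (V x y / Q x y) ≤ c) :
    ∃ B : ℝ, ∀ δ : ℝ, 0 < δ → ∀ N : ℕ, 0 < N → ∀ (M : ℕ) (f : Fin M → (n : ℕ) → (Fin n → Y) → X)
      (d : (Fin N → Y) → Fin M), 0 < M →
      1 ≤ B / (N * δ ^ 2) + (2 : ℝ) ^ (N * (c + δ)) / M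
        + (2 : ℝ) ^ (N * (E + δ)) * condProb W f (fun m y => d y ≠ m) := by
  classical
  obtain ⟨B₁, h₁⟩ := exists_tail_bound V (fun x b => Real.logb 2 (V x b / W x b)) hE
  obtain ⟨B₂, h₂⟩ := exists_tail_bound V (fun x b => Real.logb 2 (V x b / Q x b)) hc
  refine ⟨B₁ + B₂, fun δ hδ N hN M f d hM => ?_⟩
  have hM' : (0 : ℝ) < M := by exact_mod_cast hM
  have change : ∀ (Z : DMC X Y) (a : ℝ), (∀ x y, Z x y = 0 → V x y = 0) →
      ∀ m (y : Fin N → Y), pathWeight V (f m) y ≤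
      (if a < pathSum (fun x b => Real.logb 2 (V x b / Z x b)) (f m) y
        then pathWeight V (f m) y else 0) + 2 ^ a * pathWeight Z (f m) y := by
    intro Z a hZ m y
    have hz := pathWeight_nonneg Z (f m) y
    split_ifs with hy
    · have : (0 : ℝ) < 2 ^ a := by positivity
      nlinarith
    · rw [zero_add]
      refine (pathWeight_le_rpow_mul V Z hZ (f m) y).trans ?_
      exact mul_le_mul_of_nonneg_right
        (Real.rpow_le_rpow_of_exponent_le one_le_two (not_lt.mp hy)) hz
  -- Outside the two tails, correctly decoded outputs are charged to `Q` and wrongly decoded ones to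
  -- `W`.
  have hpt : ∀ m (y : Fin N → Y), pathWeight V (f m) y ≤
      (if N * (E + δ) < pathSum (fun x b => Real.logb 2 (V x b / W x b)) (f m) y
        then pathWeight V (f m) y else 0)
      + (if N * (c + δ) < pathSum (fun x b => Real.logb 2 (V x b / Q x b)) (f m) y
        then pathWeight V (f m) y else 0)
      + 2 ^ (N * (c + δ)) * (if d y = m then pathWeight Q (f m) y else 0)
      + 2 ^ (N * (E + δ)) * (if d y ≠ m then pathWeight W (f m) y else 0) := by
    intro m y
    have t₁ := change W (N * (E + δ)) hVW m y
    have t₂ := change Q (N * (c + δ)) hVQ m y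
    have hv := pathWeight_nonneg V (f m) y
    by_cases hd : d y = m
    · simp only [hd, ne_eq, not_true_eq_false, if_true, if_false, mul_zero, add_zero]
      refine t₂.trans ?_
      split_ifs <;> linarith
    · simp only [hd, ne_eq, not_false_eq_true, if_true, if_false, mul_zero, add_zero]
      refine t₁.trans ?_
      split_ifs <;> linarith
  -- The path weight under `Q` is the same for all messages, and each output decodes to exactly one
  -- message.
  have hq : ∑ m, ∑ y : Fin N → Y, (if d y = m then pathWeight Q (f m) y else 0) = 1 := by
    have hcst : ∀ m m' (y : Fin N → Y), pathWeight Q (f m) y = pathWeight Q (f m') y :=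
      fun m m' y => Finset.prod_congr rfl fun i _ => congrFun (hQ _ _) _
    rw [Finset.sum_comm, ← sum_pathWeight Q (f ⟨0, hM⟩) N]
    refine Finset.sum_congr rfl fun y _ => ?_
    rw [Finset.sum_ite_eq]
    simpa using hcst _ _ y
  have hsum : (M : ℝ) ≤ M * (B₁ / (N * δ ^ 2)) + M * (B₂ / (N * δ ^ 2))
      + 2 ^ (N * (c + δ)) + 2 ^ (N * (E + δ)) *
        ∑ m, ∑ y : Fin N → Y, (if d y ≠ m then pathWeight W (f m) y else 0) := by
    have hcard : ∀ b : ℝ, (M : ℝ) * b = ∑ _m : Fin M, b := fun b => by simp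
    calc (M : ℝ) = ∑ m, ∑ y : Fin N → Y, pathWeight V (f m) y := by
          simp [sum_pathWeight]
      _ ≤ _ := Finset.sum_le_sum fun m _ => Finset.sum_le_sum fun y _ => hpt m y
      _ ≤ _ := by
          simp only [Finset.sum_add_distrib, ← Finset.mul_sum]
          rw [hq, mul_one, hcard, hcard]
          gcongr with m _ m _
          · exact h₁ δ hδ N hN (f m)
          · exact h₂ δ hδ N hN (f m)
  have hdist : condProb W f (fun m y => d y ≠ m)
      = (1 / M : ℝ) * ∑ m, ∑ y : Fin N → Y, (if d y ≠ m then pathWeight W (f m) y else 0) := by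
    simp only [condProb, Finset.mul_sum, mul_ite, mul_zero]
    congr! 3
  rw [hdist]
  refine le_of_mul_le_mul_left ?_ hM'
  refine (mul_one (M : ℝ)).le.trans (hsum.trans (le_of_eq ?_))
  field_simp

end Paths

/-! ### Relative entropy and its joint convexity. -/

section Divergence

variable {X Y : Type*} [Fintype Y]

/-- The relative entropy sum in bits, meaningful when `p` is dominated by `q`. -/
def klSum (p q : Y → ℝ) : ℝ := ∑ y, p y * Real.logb 2 (p y / q y)

lemma klBits_le_coe_iff {p q : Y → ℝ} {E : ℝ} :
    klBits p q ≤ (E : EReal) ↔ (∀ y, q y = 0 → p y = 0) ∧ klSum p q ≤ E := by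
  unfold klBits klSum
  split_ifs with h
  · obtain ⟨y, hq, hp⟩ := h
    simp only [top_le_iff, EReal.coe_ne_top, false_iff, not_and]
    exact fun h' => absurd (h' y hq) hp
  · push Not at h
    rw [EReal.coe_le_coe_iff]
    exact ⟨fun h' => ⟨h, h'⟩, fun h' => h'.2⟩

/-- This is `log z ≤ z - 1` at `z = r * c / a`. Taking `r = 1` gives nonnegativity of the
divergence; `r = (a + b) / (c + d)` gives the log-sum inequality, because the linear corrections
cancel. -/
lemma mul_logb_div_ge {a c r : ℝ} (ha : 0 ≤ a) (hc : 0 ≤ c) (hac : c = 0 → a = 0) (hr : 0 < r) :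
    a * Real.logb 2 r + (a - r * c) / Real.log 2 ≤ a * Real.logb 2 (a / c) := by
  have h2 : 0 < Real.log 2 := Real.log_pos one_lt_two
  rcases ha.eq_or_lt with rfl | ha
  · simp only [zero_mul, zero_add, zero_sub]
    exact div_nonpos_of_nonpos_of_nonneg (by nlinarith) h2.le
  have hc : 0 < c := hc.lt_of_ne' fun h => ha.ne' (hac h)
  have := Real.log_le_sub_one_of_pos (x := r * c / a) (by positivity)
  rw [Real.log_div (by positivity) ha.ne', Real.log_mul hr.ne' hc.ne'] at this
  have h3 : a * (Real.log r + Real.log c - Real.log a) ≤ r * c - a := by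
    calc _ ≤ a * (r * c / a - 1) := mul_le_mul_of_nonneg_left this ha.le
      _ = _ := by field_simp
  rw [Real.logb, Real.logb, Real.log_div ha.ne' hc.ne', mul_div_assoc', mul_div_assoc',
    ← add_div]
  refine div_le_div_of_nonneg_right ?_ h2.le
  linarith

lemma klSum_nonneg {p q : Y → ℝ} (hp : ∀ y, 0 ≤ p y) (hq : ∀ y, 0 ≤ q y)
    (hpq : ∀ y, q y = 0 → p y = 0) (hs : ∑ y, q y ≤ ∑ y, p y) : 0 ≤ klSum p q := by
  have h : ∀ y ∈ Finset.univ, (p y - q y) / Real.log 2 ≤ p y * Real.logb 2 (p y / q y) :=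
    fun y _ => by simpa using mul_logb_div_ge (hp y) (hq y) (hpq y) one_pos
  refine le_trans ?_ (Finset.sum_le_sum h)
  rw [← Finset.sum_div, Finset.sum_sub_distrib]
  exact div_nonneg (by linarith) (Real.log_pos one_lt_two).le

lemma add_mul_logb_div_le {a b c d : ℝ} (ha : 0 ≤ a) (hb : 0 ≤ b) (hc : 0 ≤ c) (hd : 0 ≤ d)
    (hac : c = 0 → a = 0) (hbd : d = 0 → b = 0) :
    (a + b) * Real.logb 2 ((a + b) / (c + d))
      ≤ a * Real.logb 2 (a / c) + b * Real.logb 2 (b / d) := by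
  rcases (add_nonneg ha hb).eq_or_lt with h | h
  · have h1 : a = 0 := by linarith
    have h2 : b = 0 := by linarith
    simp [h1, h2]
  have hcd : 0 < c + d := by
    refine (add_nonneg hc hd).lt_of_ne' fun h' => h.ne' ?_
    rw [hac (by linarith), hbd (by linarith), add_zero]
  have hr : 0 < (a + b) / (c + d) := div_pos h hcd
  have t₁ := mul_logb_div_ge ha hc hac hr
  have t₂ := mul_logb_div_ge hb hd hbd hr
  have : (a - (a + b) / (c + d) * c) / Real.log 2 + (b - (a + b) / (c + d) * d) / Real.log 2
      = 0 := by
    field_simp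
    ring
  linarith

/-- Joint convexity of the relative entropy. -/
lemma klSum_convex {p p' q q' : Y → ℝ} (hp : ∀ y, 0 ≤ p y) (hp' : ∀ y, 0 ≤ p' y)
    (hq : ∀ y, 0 ≤ q y) (hq' : ∀ y, 0 ≤ q' y) (hpq : ∀ y, q y = 0 → p y = 0)
    (hpq' : ∀ y, q' y = 0 → p' y = 0) {s t : ℝ} (hs : 0 < s) (ht : 0 < t) :
    klSum (fun y => s * p y + t * p' y) (fun y => s * q y + t * q' y)
      ≤ s * klSum p q + t * klSum p' q' := by
  unfold klSum
  rw [Finset.mul_sum, Finset.mul_sum, ← Finset.sum_add_distrib]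
  refine Finset.sum_le_sum fun y _ => ?_
  have := add_mul_logb_div_le (mul_nonneg hs.le (hp y)) (mul_nonneg ht.le (hp' y))
    (mul_nonneg hs.le (hq y)) (mul_nonneg ht.le (hq' y))
    (fun h => by rw [hpq y (by simpa [hs.ne'] using h), mul_zero])
    (fun h => by rw [hpq' y (by simpa [ht.ne'] using h), mul_zero])
  rw [mul_div_mul_left _ _ hs.ne', mul_div_mul_left _ _ ht.ne'] at this
  linarith

end Divergence

/-! ### Convex combinations of channels. -/

section Mixture

variable {X Y : Type*} [Fintype Y]

/-- The convex combination of two channels. -/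
def DMC.mix (V V' : DMC X Y) {t : ℝ} (h0 : 0 ≤ t) (h1 : t ≤ 1) : DMC X Y where
  prob x y := (1 - t) * V x y + t * V' x y
  nonneg x y := add_nonneg (mul_nonneg (by linarith) (V.nonneg _ _)) (mul_nonneg h0 (V'.nonneg _ _))
  sum_one x := by
    rw [Finset.sum_add_distrib, ← Finset.mul_sum, ← Finset.mul_sum, V.sum_one, V'.sum_one]
    ring

/-- `V` is dominated by `W`, with all divergences `D(V(·|x) ‖ W(·|x))` at most `E`. -/
def DivLE (V W : DMC X Y) (E : ℝ) : Prop :=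
  ∀ x, (∀ y, W x y = 0 → V x y = 0) ∧ klSum (V x) (W x) ≤ E

lemma maxDiv_le_coe_iff {V W : DMC X Y} {E : ℝ} : maxDiv V W ≤ (E : EReal) ↔ DivLE V W E := by
  unfold maxDiv DivLE
  simp only [iSup_le_iff, klBits_le_coe_iff]

lemma DivLE.mix {V V' W W' : DMC X Y} {E E' t : ℝ} (h : DivLE V W E) (h' : DivLE V' W' E')
    (h0 : 0 < t) (h1 : t < 1) :
    DivLE (V.mix V' h0.le h1.le) (W.mix W' h0.le h1.le) ((1 - t) * E + t * E') := by
  have hs : 0 < 1 - t := by linarith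
  intro x
  refine ⟨fun y hy => ?_, ?_⟩
  · have hy : (1 - t) * W x y + t * W' x y = 0 := hy
    have a := mul_nonneg hs.le (W.nonneg x y)
    have b := mul_nonneg h0.le (W'.nonneg x y)
    have e₁ : (1 - t) * W x y = 0 := by linarith
    have e₂ : t * W' x y = 0 := by linarith
    change (1 - t) * V x y + t * V' x y = 0
    rw [(h x).1 y (by simpa [hs.ne'] using e₁), (h' x).1 y (by simpa [h0.ne'] using e₂)]
    simp
  · refine (klSum_convex (V.nonneg x) (V'.nonneg x) (W.nonneg x) (W'.nonneg x) (h x).1 (h' x).1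
      hs h0).trans ?_
    have a := mul_le_mul_of_nonneg_left (h x).2 hs.le
    have b := mul_le_mul_of_nonneg_left (h' x).2 h0.le
    linarith

lemma DMC.mix_self (W : DMC X Y) {t : ℝ} (h0 : 0 ≤ t) (h1 : t ≤ 1) : W.mix W h0 h1 = W := by
  cases W
  simp only [DMC.mix, DMC.mk.injEq]
  funext x y
  ring

end Mixture

/-! ### Capacity and the optimal output distribution. -/

section Capacity

variable {X Y : Type*} [Fintype X] [Fintype Y]

/-- The output distribution of `V` under the input distribution `P`. -/
def outputDist (P : X → ℝ) (V : DMC X Y) (y : Y) : ℝ := ∑ x, P x * V x y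

lemma outputDist_nonneg {P : X → ℝ} (hP : P ∈ stdSimplex ℝ X) (V : DMC X Y) (y : Y) :
    0 ≤ outputDist P V y :=
  Finset.sum_nonneg fun x _ => mul_nonneg (hP.1 x) (V.nonneg _ _)

lemma sum_outputDist {P : X → ℝ} (hP : P ∈ stdSimplex ℝ X) (V : DMC X Y) :
    ∑ y, outputDist P V y = 1 := by
  unfold outputDist
  rw [Finset.sum_comm]
  simp_rw [← Finset.mul_sum, V.sum_one, mul_one]
  exact hP.2

lemma mul_eq_zero_of_outputDist_eq_zero {P : X → ℝ} (hP : P ∈ stdSimplex ℝ X) (V : DMC X Y)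
    {y : Y} (h : outputDist P V y = 0) (x : X) : P x * V x y = 0 :=
  (Finset.sum_eq_zero_iff_of_nonneg fun x _ => mul_nonneg (hP.1 x) (V.nonneg x y)).mp h x
    (Finset.mem_univ x)

/-- The compensation identity `∑ P(x) D(V(·|x) ‖ q) = I(P; V) + D(PV ‖ q)`. -/
lemma sum_mul_klSum {P : X → ℝ} (hP : P ∈ stdSimplex ℝ X) (V : DMC X Y) {q : Y → ℝ}
    (hq : ∀ y, q y = 0 → outputDist P V y = 0) :
    ∑ x, P x * klSum (V x) q = mutualInfo P V + klSum (outputDist P V) q := by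
  have e : klSum (outputDist P V) q
      = ∑ x, ∑ y, P x * V x y * Real.logb 2 (outputDist P V y / q y) := by
    rw [Finset.sum_comm]
    refine Finset.sum_congr rfl fun y _ => ?_
    rw [← Finset.sum_mul]
    rfl
  rw [e, mutualInfo, ← Finset.sum_add_distrib]
  refine Finset.sum_congr rfl fun x _ => ?_
  rw [klSum, Finset.mul_sum, ← Finset.sum_add_distrib]
  refine Finset.sum_congr rfl fun y _ => ?_
  change _ = P x * V x y * Real.logb 2 (V x y / outputDist P V y) + _
  by_cases h : P x * V x y = 0
  · rw [← mul_assoc, h]; simp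
  have ho : outputDist P V y ≠ 0 := fun h' => h (mul_eq_zero_of_outputDist_eq_zero hP V h' x)
  have hq' : q y ≠ 0 := fun h' => ho (hq y h')
  have hv : V x y ≠ 0 := right_ne_zero_of_mul h
  rw [Real.logb_div hv hq', Real.logb_div hv ho, Real.logb_div ho hq']
  ring

/-- On the simplex the mutual information is a linear term plus the output entropy, and `p log p` is
continuous even at zero. -/
lemma continuousOn_mutualInfo (V : DMC X Y) :
    ContinuousOn (fun P => mutualInfo P V) (stdSimplex ℝ X) := by
  have e : ∀ P ∈ stdSimplex ℝ X, mutualInfo P V =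
      (∑ x, ∑ y, P x * V x y * Real.logb 2 (V x y))
        - ∑ y, outputDist P V y * Real.log (outputDist P V y) / Real.log 2 := by
    intro P hP
    have e : ∑ y, outputDist P V y * Real.log (outputDist P V y) / Real.log 2
        = ∑ x, ∑ y, P x * V x y * Real.logb 2 (outputDist P V y) := by
      rw [Finset.sum_comm]
      refine Finset.sum_congr rfl fun y _ => ?_
      rw [← Finset.sum_mul, mul_div_assoc]
      rfl
    rw [e, mutualInfo, ← Finset.sum_sub_distrib]
    refine Finset.sum_congr rfl fun x _ => ?_
    rw [← Finset.sum_sub_distrib]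
    refine Finset.sum_congr rfl fun y _ => ?_
    change P x * V x y * Real.logb 2 (V x y / outputDist P V y) = _
    by_cases h : P x * V x y = 0
    · simp [h]
    have ho : outputDist P V y ≠ 0 := fun h' => h (mul_eq_zero_of_outputDist_eq_zero hP V h' x)
    rw [Real.logb_div (right_ne_zero_of_mul h) ho]
    ring
  refine ContinuousOn.congr (Continuous.continuousOn ?_) e
  have ho : ∀ y, Continuous fun P : X → ℝ => outputDist P V y := by
    intro y; unfold outputDist; fun_prop
  refine Continuous.sub (by fun_prop) (continuous_finsetSum _ fun y _ => ?_)
  exact (Real.continuous_mul_log.comp (ho y)).div_const _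

lemma exists_capacity_eq [Nonempty X] (V : DMC X Y) :
    ∃ P ∈ stdSimplex ℝ X, capacity V = (mutualInfo P V : EReal) ∧
      ∀ P' ∈ stdSimplex ℝ X, mutualInfo P' V ≤ mutualInfo P V := by
  classical
  have hne : (stdSimplex ℝ X).Nonempty :=
    ⟨_, single_mem_stdSimplex ℝ (Classical.arbitrary X)⟩
  obtain ⟨P, hP, hmax⟩ :=
    (isCompact_stdSimplex ℝ X).exists_isMaxOn hne (continuousOn_mutualInfo V)
  refine ⟨P, hP, le_antisymm ?_ ?_, fun P' hP' => hmax hP'⟩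
  · exact iSup₂_le fun P' hP' => EReal.coe_le_coe_iff.mpr (hmax hP')
  · exact le_iSup₂_of_le P hP le_rfl

/-- At a maximizer of the mutual information, the divergence from every row to a slightly perturbed
output distribution is at most the capacity. -/
lemma klSum_perturbed_le {P : X → ℝ} (hP : P ∈ stdSimplex ℝ X) (V : DMC X Y)
    (hmax : ∀ P' ∈ stdSimplex ℝ X, mutualInfo P' V ≤ mutualInfo P V) (x : X) {t : ℝ}
    (h0 : 0 < t) (h1 : t < 1) :
    klSum (V x) (fun y => (1 - t) * outputDist P V y + t * V x y) ≤ mutualInfo P V := by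
  classical
  set q : Y → ℝ := fun y => (1 - t) * outputDist P V y + t * V x y with hq
  set P' : X → ℝ := (1 - t) • P + t • Pi.single x 1 with hP'
  have hs : 0 < 1 - t := by linarith
  have hP'mem : P' ∈ stdSimplex ℝ X :=
    convex_stdSimplex ℝ X hP (single_mem_stdSimplex ℝ x) hs.le h0.le (by ring)
  have hsum : ∀ F : X → ℝ, ∑ x', P' x' * F x' = (1 - t) * ∑ x', P x' * F x' + t * F x := by
    intro F
    simp only [hP', Pi.add_apply, Pi.smul_apply, smul_eq_mul, add_mul, Finset.sum_add_distrib,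
      Finset.mul_sum, mul_assoc]
    congr 1
    rw [← Finset.mul_sum]
    simp [Pi.single_apply]
  have hout : outputDist P' V = q := funext fun y => hsum fun x' => V x' y
  have hqn : ∀ y, 0 ≤ q y := fun y => hout ▸ outputDist_nonneg hP'mem V y
  have hdom : ∀ y, q y = 0 → outputDist P V y = 0 := by
    intro y hy
    have a := mul_nonneg h0.le (V.nonneg x y)
    have b := mul_nonneg hs.le (outputDist_nonneg hP V y)
    have hy : (1 - t) * outputDist P V y + t * V x y = 0 := hy
    have : (1 - t) * outputDist P V y = 0 := by linarith
    simpa [hs.ne'] using this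
  -- The compensation identity at `P` and at `P'`, with the same `q`, gives `(1 - t) (I(P) + D(PV ‖
  -- q)) + t D(V(·|x) ‖ q) = I(P') ≤ I(P)`. Dropping `D(PV ‖ q) ≥ 0` and dividing by `t` finishes.
  have i₁ := sum_mul_klSum hP V hdom
  have i₂ := sum_mul_klSum hP'mem V (q := q) (fun y hy => by rw [hout, hy])
  have hself : klSum q q = 0 := by
    refine Finset.sum_eq_zero fun y _ => ?_
    by_cases h : q y = 0
    · simp [h]
    · simp [div_self h]
  rw [hout, hself, add_zero, hsum fun x' => klSum (V x') q, i₁] at i₂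
  have hpos : 0 ≤ klSum (outputDist P V) q := by
    refine klSum_nonneg (outputDist_nonneg hP V) hqn hdom ?_
    rw [← hout, sum_outputDist hP, sum_outputDist hP'mem]
  have hle := hmax P' hP'mem
  rw [← i₂] at hle
  have := mul_nonneg hs.le hpos
  refine le_of_mul_le_mul_left ?_ h0
  linarith

/-- Let `t → 0` in `klSum_perturbed_le`. Domination must come first: a letter reached from `x` but
missed by the optimal output would contribute a term of order `log (1 / t)`, contradicting the
uniform bound. -/
lemma klSum_outputDist_le {P : X → ℝ} (hP : P ∈ stdSimplex ℝ X) (V : DMC X Y)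
    (hmax : ∀ P' ∈ stdSimplex ℝ X, mutualInfo P' V ≤ mutualInfo P V) (x : X) :
    (∀ y, outputDist P V y = 0 → V x y = 0) ∧
      klSum (V x) (outputDist P V) ≤ mutualInfo P V := by
  have hle1 : ∀ y, V x y ≤ 1 := fun y => (V.sum_one x) ▸
    Finset.single_le_sum (f := V x) (fun y _ => V.nonneg x y) (Finset.mem_univ y)
  have hole1 : ∀ y, outputDist P V y ≤ 1 := fun y => (sum_outputDist hP V) ▸
    Finset.single_le_sum (f := outputDist P V) (fun y _ => outputDist_nonneg hP V y)
      (Finset.mem_univ y)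
  have hdom : ∀ y, outputDist P V y = 0 → V x y = 0 := by
    intro y₀ hy₀
    classical
    by_contra hne
    have hv₀ : 0 < V x y₀ := (V.nonneg x y₀).lt_of_ne' hne
    set H : ℝ := ∑ y, V x y * Real.logb 2 (V x y) with hH
    -- Here `t = 2 ^ (-s)`. The letter `y₀` has perturbed mass `t * V x y₀` and contributes exactly
    -- `V x y₀ * s`; elsewhere the denominator is at most one.
    have key : ∀ s : ℝ, 0 < s → H + V x y₀ * s ≤ mutualInfo P V := by
      intro s hs
      have ht0 : (0 : ℝ) < 2 ^ (-s) := by positivity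
      have ht1 : (2 : ℝ) ^ (-s) < 1 := Real.rpow_lt_one_of_one_lt_of_neg one_lt_two (by linarith)
      refine le_trans ?_ (klSum_perturbed_le hP V hmax x ht0 ht1)
      have e : V x y₀ * s = ∑ y, if y = y₀ then V x y₀ * s else 0 := by simp
      rw [e, hH, ← Finset.sum_add_distrib]
      refine Finset.sum_le_sum fun y _ => ?_
      rcases (V.nonneg x y).eq_or_lt with h | h
      · have : y ≠ y₀ := by rintro rfl; exact hne h.symm
        simp [← h, this]
      by_cases hy : y = y₀
      · subst hy
        simp only [if_true, hy₀, mul_zero, zero_add]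
        rw [div_mul_cancel_right₀ h.ne', Real.logb_inv, Real.logb_rpow two_pos (by norm_num)]
        have : Real.logb 2 (V x y) ≤ 0 := Real.logb_nonpos one_lt_two h.le (hle1 y)
        nlinarith
      · simp only [hy, if_false, add_zero]
        refine mul_le_mul_of_nonneg_left ?_ h.le
        have hon := outputDist_nonneg hP V y
        have hpos : 0 < (1 - (2 : ℝ) ^ (-s)) * outputDist P V y + 2 ^ (-s) * V x y :=
          add_pos_of_nonneg_of_pos (mul_nonneg (by linarith) hon) (mul_pos ht0 h)
        refine Real.logb_le_logb_of_le one_lt_two h ?_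
        rw [le_div_iff₀ hpos]
        have : (1 - (2 : ℝ) ^ (-s)) * outputDist P V y + 2 ^ (-s) * V x y ≤ 1 := by
          nlinarith [hole1 y, hle1 y]
        nlinarith
    have hs : 0 < (|mutualInfo P V - H| + 1) / V x y₀ := by positivity
    have := key _ hs
    rw [mul_div_cancel₀ _ hne] at this
    linarith [le_abs_self (mutualInfo P V - H)]
  refine ⟨hdom, ?_⟩
  have hcont : ContinuousAt
      (fun t : ℝ => klSum (V x) (fun y => (1 - t) * outputDist P V y + t * V x y)) 0 := by
    unfold klSum
    refine tendsto_finsetSum _ fun y _ => ?_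
    by_cases h : V x y = 0
    · simp [h]
    have ho : outputDist P V y ≠ 0 := fun h' => h (hdom y h')
    have : ContinuousAt (fun t : ℝ => (1 - t) * outputDist P V y + t * V x y) 0 := by fun_prop
    have h3 : ContinuousAt
        (fun t : ℝ => Real.log (V x y / ((1 - t) * outputDist P V y + t * V x y))) 0 :=
      (ContinuousAt.div continuousAt_const this (by simpa using ho)).log (by simp [h, ho])
    exact (h3.div_const _).const_mul _
  have ht : Filter.Tendsto
      (fun t : ℝ => klSum (V x) (fun y => (1 - t) * outputDist P V y + t * V x y))
      (nhdsWithin 0 (Set.Ioi 0)) (nhds (klSum (V x) (outputDist P V))) := by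
    have := hcont.tendsto.mono_left (nhdsWithin_le_nhds (s := Set.Ioi 0))
    simpa using this
  refine le_of_tendsto ht ?_
  filter_upwards [Ioo_mem_nhdsGT (zero_lt_one' ℝ)] with t ht
  exact klSum_perturbed_le hP V hmax x ht.1 ht.2

/-- A channel of capacity at most `c` has an output distribution within divergence `c` of every
row. -/
lemma exists_output_divLE [Nonempty X] {V : DMC X Y} {c : ℝ} (hc : capacity V ≤ (c : EReal)) :
    ∃ Q : DMC X Y, (∀ x x', Q x = Q x') ∧ DivLE V Q c := by
  obtain ⟨P, hP, hcap, hmax⟩ := exists_capacity_eq V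
  rw [hcap, EReal.coe_le_coe_iff] at hc
  refine ⟨⟨fun _ => outputDist P V, fun _ => outputDist_nonneg hP V,
    fun _ => sum_outputDist hP V⟩, fun _ _ => rfl, fun x => ?_⟩
  have := klSum_outputDist_le hP V hmax x
  exact ⟨this.1, this.2.trans hc⟩

end Capacity

/-! ### Event probabilities, conditioned on the common randomness. -/

section Events

variable {X Y : Type*} [Fintype Y] {M : ℕ}

lemma weight_nonneg (W : DMC X Y) (f : (n : ℕ) → (Fin n → Y) → X) {N : ℕ} (y : Fin N → Y) :
    0 ≤ (1 / M : ℝ) * pathWeight W f y :=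
  mul_nonneg (by positivity) (pathWeight_nonneg W f y)

lemma condProb_nonneg (W : DMC X Y) (f : Fin M → (n : ℕ) → (Fin n → Y) → X) {N : ℕ}
    (A : Fin M → (Fin N → Y) → Prop) : 0 ≤ condProb W f A :=
  Finset.sum_nonneg fun m _ => Finset.sum_nonneg fun y _ => by
    split_ifs
    exacts [weight_nonneg W (f m) y, le_rfl]

lemma condProb_le_add (W : DMC X Y) (f : Fin M → (n : ℕ) → (Fin n → Y) → X) {N : ℕ}
    {A B C : Fin M → (Fin N → Y) → Prop} (h : ∀ m y, A m y → B m y ∨ C m y) :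
    condProb W f A ≤ condProb W f B + condProb W f C := by
  unfold condProb
  rw [← Finset.sum_add_distrib]
  refine Finset.sum_le_sum fun m _ => ?_
  rw [← Finset.sum_add_distrib]
  refine Finset.sum_le_sum fun y _ => ?_
  have hw := weight_nonneg (M := M) W (f m) y
  have := h m y
  split_ifs <;> first | linarith | tauto

lemma condProb_true (W : DMC X Y) (f : Fin M → (n : ℕ) → (Fin n → Y) → X) (N : ℕ) (hM : 0 < M) :
    condProb W f (fun _ (_ : Fin N → Y) => True) = 1 := by
  have : (M : ℝ) ≠ 0 := by exact_mod_cast hM.ne'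
  simp [condProb, ← Finset.mul_sum, sum_pathWeight, this]

lemma condProb_false (W : DMC X Y) (f : Fin M → (n : ℕ) → (Fin n → Y) → X) (N : ℕ) :
    condProb W f (fun _ (_ : Fin N → Y) => False) = 0 := by
  simp [condProb]

lemma condProb_le_one (W : DMC X Y) (f : Fin M → (n : ℕ) → (Fin n → Y) → X) {N : ℕ}
    (A : Fin M → (Fin N → Y) → Prop) : condProb W f A ≤ 1 := by
  rcases Nat.eq_zero_or_pos M with rfl | hM
  · simp [condProb]
  · have := condProb_le_add W f (A := A) (B := fun _ _ => True) (C := fun _ _ => False)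
      fun _ _ _ => Or.inl trivial
    rwa [condProb_true W f N hM, condProb_false, add_zero] at this

lemma condProb_take (W : DMC X Y) (f : Fin M → (n : ℕ) → (Fin n → Y) → X) {l N : ℕ} (h : l ≤ N)
    (A : Fin M → (Fin l → Y) → Prop) :
    condProb W f (fun m (y : Fin N → Y) => A m (Fin.take l h y)) = condProb W f A := by
  classical
  refine Finset.sum_congr rfl fun m _ => ?_
  have := sum_take_mul_pathWeight W (f m) h (fun y => if A m y then (1 / M : ℝ) else 0)
  simp only [ite_mul, zero_mul] at this
  convert this

namespace FeedbackEncoder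

variable (c : FeedbackEncoder X Y M) (W : DMC X Y)

lemma eventProb_eq (N : ℕ) (A : c.𝒰 → Fin M → (Fin N → Y) → Prop) :
    c.eventProb W N A
      = (∫⁻ u, ENNReal.ofReal (condProb W (fun m n => c.enc n u m) (A u)) ∂c.law).toReal := by
  classical
  unfold eventProb condProb
  congr 1
  refine lintegral_congr fun u => ?_
  rw [ENNReal.ofReal_sum_of_nonneg]
  · refine Finset.sum_congr rfl fun m _ => ?_
    rw [ENNReal.ofReal_sum_of_nonneg]
    · refine Finset.sum_congr rfl fun y _ => ?_
      rw [apply_ite ENNReal.ofReal, ENNReal.ofReal_zero]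
      rfl
    · intro y _
      split_ifs
      exacts [weight_nonneg W _ y, le_rfl]
  · refine fun m _ => Finset.sum_nonneg fun y _ => ?_
    split_ifs
    exacts [weight_nonneg W _ y, le_rfl]

lemma lintegral_condProb_le_one {N : ℕ} (A : c.𝒰 → Fin M → (Fin N → Y) → Prop) :
    ∫⁻ u, ENNReal.ofReal (condProb W (fun m n => c.enc n u m) (A u)) ∂c.law ≤ 1 := by
  calc _ ≤ ∫⁻ _, 1 ∂c.law := lintegral_mono fun u =>
        ENNReal.ofReal_le_one.mpr (condProb_le_one W _ _)
    _ = 1 := by simp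

lemma eventProb_le_one (N : ℕ) (A : c.𝒰 → Fin M → (Fin N → Y) → Prop) :
    c.eventProb W N A ≤ 1 := by
  rw [eventProb_eq]
  exact ENNReal.toReal_le_of_le_ofReal zero_le_one
    (by simpa using c.lintegral_condProb_le_one W A)

/-- Transfers converse bounds for deterministic strategies, valid for each value of `U`, to
randomized codes. -/
lemma le_eventProb {N : ℕ} {A : c.𝒰 → Fin M → (Fin N → Y) → Prop} {κ : ℝ}
    (h : ∀ u, κ ≤ condProb W (fun m n => c.enc n u m) (A u)) : κ ≤ c.eventProb W N A := by
  rw [eventProb_eq]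
  refine (ENNReal.ofReal_le_iff_le_toReal
    ((c.lintegral_condProb_le_one W A).trans_lt ENNReal.one_lt_top).ne).mp ?_
  calc ENNReal.ofReal κ = ∫⁻ _, ENNReal.ofReal κ ∂c.law := by simp
    _ ≤ _ := lintegral_mono fun u => ENNReal.ofReal_le_ofReal (h u)

lemma eventProb_take {l N : ℕ} (h : l ≤ N) (A : c.𝒰 → Fin M → (Fin l → Y) → Prop) :
    c.eventProb W N (fun u m y => A u m (Fin.take l h y)) = c.eventProb W l A := by
  simp only [eventProb_eq, condProb_take W _ h]

lemma measurable_pathWeight [Finite X] {N : ℕ} (m : Fin M) (y : Fin N → Y) :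
    Measurable fun u => pathWeight W (fun n => c.enc n u m) y := by
  refine Finset.measurable_fun_prod _ fun i _ => ?_
  let _ : MeasurableSpace X := ⊤
  have h : Measurable fun u => c.enc i u m (Fin.take i i.isLt.le y) :=
    measurable_to_countable' fun x => c.measurable_enc i m _ x
  exact (measurable_from_top (f := fun x => W x (y i))).comp h

lemma measurable_condProb [Finite X] {N : ℕ} {A : c.𝒰 → Fin M → (Fin N → Y) → Prop}
    (hA : ∀ m y, MeasurableSet {u | A u m y}) :
    Measurable fun u => condProb W (fun m n => c.enc n u m) (A u) := by
  classical
  refine Finset.measurable_fun_sum _ fun m _ => Finset.measurable_fun_sum _ fun y _ => ?_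
  exact Measurable.ite (hA m y) ((c.measurable_pathWeight W m y).const_mul _) measurable_const

lemma eventProb_le_add [Finite X] {N : ℕ} {A B C : c.𝒰 → Fin M → (Fin N → Y) → Prop}
    (h : ∀ u m y, A u m y → B u m y ∨ C u m y) (hC : ∀ m y, MeasurableSet {u | C u m y}) :
    c.eventProb W N A ≤ c.eventProb W N B + c.eventProb W N C := by
  simp only [eventProb_eq]
  have fin := fun A : c.𝒰 → Fin M → (Fin N → Y) → Prop =>
    ((c.lintegral_condProb_le_one W A).trans_lt ENNReal.one_lt_top).ne
  rw [← ENNReal.toReal_add (fin B) (fin C),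
    ← lintegral_add_right _ (c.measurable_condProb W hC).ennreal_ofReal]
  refine ENNReal.toReal_mono ?_ (lintegral_mono fun u => ?_)
  · rw [lintegral_add_right _ (c.measurable_condProb W hC).ennreal_ofReal]
    exact ENNReal.add_ne_top.mpr ⟨fin B, fin C⟩
  · rw [← ENNReal.ofReal_add (condProb_nonneg W _ _) (condProb_nonneg W _ _)]
    exact ENNReal.ofReal_le_ofReal (condProb_le_add W _ (h u))

end FeedbackEncoder

end Events

/-! ### From almost-fixed-length codes to error-erasure codes. -/

section Erasure

variable {X Y : Type*} [Fintype Y] {M : ℕ}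

/-- Prolong an output sequence by an arbitrary letter. -/
def padTo [Nonempty Y] (N : ℕ) {n : ℕ} (y : Fin n → Y) (i : Fin N) : Y :=
  if h : (i : ℕ) < n then y ⟨i, h⟩ else Classical.arbitrary Y

namespace AFLFCode

variable {W : DMC X Y} {l K : ℕ} {γ ε : ℝ} [Nonempty Y] (c : AFLFCode W l M γ K ε)

open Classical in
/-- Decode as in an almost-fixed-length code if it has stopped by time `n`, and erase otherwise. -/
def truncDec (n : ℕ) (u : c.𝒰) (y : Fin n → Y) : Option (Fin M) :=
  if c.τ u (padTo (K * l) y) ≤ n then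
    some (c.dec (c.τ u (padTo (K * l) y)) u (Fin.take _ (c.τ_le u _) (padTo (K * l) y)))
  else none

/-- Split over the countably many values of `τ`; on each piece a single decoder is in force. -/
lemma measurableSet_truncDec (n : ℕ) (y : Fin n → Y) (w : Option (Fin M)) :
    MeasurableSet {u | c.truncDec n u y = w} := by
  set z : Fin (K * l) → Y := padTo (K * l) y with hz
  have hval : ∀ t : ℕ, MeasurableSet {u | c.τ u z = t ∧ c.truncDec n u y = w} := by
    intro t
    by_cases ht : t ≤ K * l
    · have : {u | c.τ u z = t ∧ c.truncDec n u y = w}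
          = {u | c.τ u z = t} ∩
            {u | (if t ≤ n then some (c.dec t u (Fin.take t ht z)) else none) = w} := by
        ext u
        simp only [Set.mem_ofPred_eq, Set.mem_inter_iff]
        refine and_congr_right fun h => ?_
        subst h
        unfold truncDec
        simp only [← hz]
        constructor <;> intro h <;> convert h
      rw [this]
      refine (c.measurable_τ z t).inter ?_
      by_cases htn : t ≤ n
      · simp only [htn, if_true]
        cases w with
        | none => simp
        | some w => simpa using c.measurable_dec t (Fin.take t ht z) w
      · simp [htn]
    · have : {u | c.τ u z = t ∧ c.truncDec n u y = w} = ∅ := by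
        ext u
        simp only [Set.mem_ofPred_eq, Set.mem_empty_iff_false, iff_false, not_and]
        intro h
        exact absurd (h ▸ c.τ_le u z) ht
      rw [this]
      exact MeasurableSet.empty
  have : {u | c.truncDec n u y = w} = ⋃ t : ℕ, {u | c.τ u z = t ∧ c.truncDec n u y = w} := by
    ext u
    simp
  rw [this]
  exact MeasurableSet.iUnion hval

omit [Fintype Y] in
lemma padTo_take_eq {N n : ℕ} (h : n ≤ N) (y : Fin N → Y) (i : Fin N) (hi : (i : ℕ) < n) :
    padTo N (Fin.take n h y) i = y i := by
  simp [padTo, hi]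

/-- If either sequence stops by time `l`, that decision depends only on the first `l` letters, which
the two sequences share. -/
lemma τ_padTo_take (h : l ≤ K * l) (u : c.𝒰) (y : Fin (K * l) → Y)
    (hτ : c.τ u y ≤ l ∨ c.τ u (padTo (K * l) (Fin.take l h y)) ≤ l) :
    c.τ u (padTo (K * l) (Fin.take l h y)) = c.τ u y := by
  rcases hτ with hτ | hτ
  · exact c.stopping u y _ _ (fun i hi => (padTo_take_eq h y i (hi.trans_le hτ)).symm) rfl
  · exact (c.stopping u _ y _ (fun i hi => padTo_take_eq h y i (hi.trans_le hτ)) rfl).symm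

lemma truncDec_eq_none_iff (h : l ≤ K * l) (u : c.𝒰) (y : Fin (K * l) → Y) :
    c.truncDec l u (Fin.take l h y) = none ↔ l < c.τ u y := by
  have := c.τ_padTo_take h u y
  unfold truncDec
  split_ifs with hτ
  · simp only [false_iff, not_lt]
    rwa [← this (Or.inr hτ)]
  · simp only [true_iff]
    by_contra hlt
    push Not at hlt
    exact hτ (by rwa [this (Or.inl hlt)])

lemma truncDec_eq_some (h : l ≤ K * l) (u : c.𝒰) (y : Fin (K * l) → Y) (hτ : c.τ u y ≤ l) :
    c.truncDec l u (Fin.take l h y)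
      = some (c.dec (c.τ u y) u (Fin.take (c.τ u y) (c.τ_le u y) y)) := by
  have hτ' := c.τ_padTo_take h u y (Or.inl hτ)
  have key : ∀ (t : ℕ) (ht : t ≤ K * l), t = c.τ u y →
      c.dec t u (Fin.take t ht (padTo (K * l) (Fin.take l h y)))
        = c.dec (c.τ u y) u (Fin.take (c.τ u y) (c.τ_le u y) y) := by
    rintro t ht rfl
    congr 1
    funext i
    exact padTo_take_eq h y _ (i.isLt.trans_le hτ)
  unfold truncDec
  rw [if_pos (by rwa [hτ']), key _ _ hτ']

/-- Erasing when an almost-fixed-length code has not stopped by time `ℓ` gives an error-erasure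
code. -/
def toErasureCode [Finite X] (hK : 1 ≤ K) (hγl : 0 < γ * l) :
    ErasureCode W l M ε ((2 : ℝ) ^ (-(γ * l))) where
  toFeedbackEncoder := c.toFeedbackEncoder
  ε_pos := c.ε_pos
  ε_lt_one := c.ε_lt_one
  εx_pos := by positivity
  εx_lt_one := Real.rpow_lt_one_of_one_lt_of_neg one_lt_two (by linarith)
  dec := c.truncDec
  measurable_dec := c.measurableSet_truncDec
  prob_error := by
    have h : l ≤ K * l := Nat.le_mul_of_pos_left l hK
    rw [← c.eventProb_take W h, ← c.eventProb_take W h, sub_le_iff_le_add]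
    refine (c.eventProb_le_add W (B := fun u m y =>
      c.dec (c.τ u y) u (Fin.take (c.τ u y) (c.τ_le u y) y) ≠ m) ?_ ?_).trans
      (add_le_add_left c.prob_error _)
    · intro u m y hne
      rcases le_or_gt (c.τ u y) l with hτ | hτ
      · rw [c.truncDec_eq_some h u y hτ] at hne
        exact Or.inl fun h' => hne (congrArg some h')
      · exact Or.inr ((c.truncDec_eq_none_iff h u y).mpr hτ)
    · exact fun _ y => c.measurableSet_truncDec l _ none
  prob_erasure := by
    have h : l ≤ K * l := Nat.le_mul_of_pos_left l hK
    rw [← c.eventProb_take W h]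
    simp only [c.truncDec_eq_none_iff h]
    exact c.prob_τ

end AFLFCode

/-- A constant encoder that shares one random bit of bias `p`. -/
def biasedBitEncoder (x : X) (M : ℕ) {p : ℝ} (h0 : 0 ≤ p) (h1 : p ≤ 1) :
    FeedbackEncoder X Y M where
  𝒰 := Bool
  mU := ⊤
  law := ENNReal.ofReal p • Measure.dirac true + ENNReal.ofReal (1 - p) • Measure.dirac false
  isProb := ⟨by simp [← ENNReal.ofReal_add h0 (sub_nonneg.mpr h1)]⟩
  enc _ _ _ _ := x
  measurable_enc _ _ _ _ := trivial

/-- Erase with probability `1 - p`, independently of everything else. -/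
lemma nonempty_erasureCode [Nonempty X] (W : DMC X Y) (l : ℕ) (hM : 0 < M) {p : ℝ} (h0 : 0 < p)
    (h1 : p < 1) : Nonempty (ErasureCode W l M p (1 - p)) := by
  obtain ⟨x⟩ := ‹Nonempty X›
  let e : FeedbackEncoder X Y M := biasedBitEncoder x M h0.le h1.le
  let d : (n : ℕ) → Bool → (Fin n → Y) → Option (Fin M) :=
    fun _ u _ => if u then some ⟨0, hM⟩ else none
  have hprob : e.eventProb W l (fun u _ y => d l u y = none) = 1 - p := by
    rw [FeedbackEncoder.eventProb_eq]
    change (∫⁻ u : Bool, ENNReal.ofReal (condProb W (fun m n => e.enc n u m)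
      (fun _ (y : Fin l → Y) => d l u y = none))
      ∂(ENNReal.ofReal p • @Measure.dirac Bool ⊤ true
        + ENNReal.ofReal (1 - p) • @Measure.dirac Bool ⊤ false)).toReal = 1 - p
    rw [lintegral_add_measure, lintegral_smul_measure, lintegral_smul_measure,
      lintegral_dirac' _ measurable_from_top, lintegral_dirac' _ measurable_from_top]
    simp [d, condProb_true W _ l hM, condProb_false, h1.le]
  exact ⟨{ toFeedbackEncoder := e
           ε_pos := h0
           ε_lt_one := h1
           εx_pos := by linarith
           εx_lt_one := by linarith
           dec := d
           measurable_dec := fun _ _ _ => trivial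
           -- The error event, erasures included, has probability at most one; subtracting `1 - p`
           -- leaves `p`.
           prob_error := by
            rw [hprob]
            linarith [e.eventProb_le_one W l fun u m y => d l u y ≠ some m]
           prob_erasure := hprob.le }⟩

/-- With erasure exponent zero any erasure probability below one is allowed, so the non-erasure
probability `p` can be made as small as the error bound demands. -/
lemma erasureAchievable_zero [Nonempty X] (W : DMC X Y) (R E : ℝ) :
    ErasureAchievable W R E 0 := by
  intro δ hδ
  refine ⟨0, fun l _ => ?_⟩
  have hp : (0 : ℝ) < min (1 / 2) (2 ^ (-(l * (E - δ)))) := lt_min (by norm_num) (by positivity)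
  have hp1 : min (1 / 2) ((2 : ℝ) ^ (-(l * (E - δ)))) < 1 :=
    (min_le_left _ _).trans_lt (by norm_num)
  refine ⟨⌈(2 : ℝ) ^ (l * R)⌉₊, _, _,
    nonempty_erasureCode W l (Nat.ceil_pos.mpr (by positivity)) hp hp1, Nat.le_ceil _,
    min_le_right _ _, ?_⟩
  refine le_trans (by linarith) (Real.one_le_rpow one_le_two ?_)
  have : 0 ≤ l * δ := by positivity
  linarith

lemma AFLFAchievable.erasureAchievable [Finite X] [Nonempty Y] {W : DMC X Y} {γ R E : ℝ} {K : ℕ}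
    (h : AFLFAchievable W γ K R E) (hγ : 0 < γ) (hK : 1 ≤ K) : ErasureAchievable W R E γ := by
  intro δ hδ
  obtain ⟨l₀, hl₀⟩ := h δ hδ
  refine ⟨max l₀ 1, fun l hl => ?_⟩
  obtain ⟨M, ε, ⟨c⟩, hM, hε⟩ := hl₀ l (le_of_max_le_left hl)
  have hl1 : (0 : ℝ) < l := by exact_mod_cast le_of_max_le_right hl
  refine ⟨M, ε, _, ⟨c.toErasureCode hK (by positivity)⟩, hM, hε, ?_⟩
  refine Real.rpow_le_rpow_of_exponent_le one_le_two ?_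
  nlinarith

lemma eAFLF_le_eErasure [Finite X] [Nonempty X] [Nonempty Y] (W : DMC X Y) (R : ℝ) {γ : ℝ}
    {K : ℕ} (hγ : 0 ≤ γ) (hK : 1 ≤ K) : eAFLF W R γ K ≤ eErasure W R γ := by
  refine iSup₂_le fun E hE => le_iSup₂_of_le E ?_ le_rfl
  rcases hγ.eq_or_lt with rfl | hγ
  · exact erasureAchievable_zero W R E
  · exact hE.erasureAchievable hγ hK

end Erasure

/-! ### The converse at the horizon `Kℓ`. -/

section Haroutunian

variable {X Y : Type*} [Fintype X] [Fintype Y]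

/-- The error exponent of almost-fixed-length codes is limited by the divergence to any auxiliary
channel for which the rate is too high. -/
lemma AFLFAchievable.le_of_divLE {V W Q : DMC X Y} (hQ : ∀ x x', Q x = Q x') {E c R γ E' : ℝ}
    {K : ℕ} (hK : 1 ≤ K) (hVW : DivLE V W E) (hVQ : DivLE V Q c) (hc : c < R / K)
    (h : AFLFAchievable W γ K R E') : E' ≤ K * E := by
  have hK' : (0 : ℝ) < K := by exact_mod_cast hK
  obtain ⟨B, hB⟩ := exists_converse_bound V W Q hQ (fun x => (hVW x).1) (fun x => (hVQ x).1)
    (fun x => (hVW x).2) (fun x => (hVQ x).2)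
  refine le_of_forall_pos_le_add fun η hη => ?_
  -- Of the slack `(K + 2) * δ`, `K * δ` pays for the change of measure over `K * l` letters, one
  -- `δ` for achievability, and one for the factor `1 / 2` through `1 ≤ l * δ`.
  obtain ⟨δ, hδ, hδη, hδc⟩ : ∃ δ > 0, (K + 2) * δ ≤ η ∧ c + δ < R / K := by
    refine ⟨min (η / (K + 2)) ((R / K - c) / 2), lt_min (by positivity) (by linarith), ?_, ?_⟩
    · rw [mul_comm, ← le_div_iff₀ (by positivity)]
      exact min_le_left _ _
    · linarith [min_le_right (η / (K + 2)) ((R / K - c) / 2)]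
  set ρ : ℝ := R - K * (c + δ) with hρ
  have hρ0 : 0 < ρ := by
    rw [lt_div_iff₀ hK'] at hδc
    linarith
  obtain ⟨l₀, hl₀⟩ := h δ hδ
  obtain ⟨l, hl, hl1, hlB, hlρ, hlδ⟩ : ∃ l : ℕ, l₀ ≤ l ∧ 1 ≤ l ∧ 4 * B ≤ l * (K * δ ^ 2) ∧
      2 ≤ l * ρ ∧ 1 ≤ l * δ := by
    have ev : ∀ a b : ℝ, 0 < b → ∀ᶠ l : ℕ in Filter.atTop, a ≤ l * b := fun a b hb =>
      (tendsto_natCast_atTop_atTop.atTop_mul_const hb).eventually_ge_atTop a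
    exact ((Filter.eventually_ge_atTop l₀).and ((Filter.eventually_ge_atTop 1).and
      ((ev (4 * B) (K * δ ^ 2) (by positivity)).and
        ((ev 2 ρ hρ0).and (ev 1 δ hδ))))).exists
  obtain ⟨M, ε, ⟨code⟩, hM, hε⟩ := hl₀ l hl
  have hl' : (0 : ℝ) < l := by exact_mod_cast hl1
  have hMpos : (0 : ℝ) < M := lt_of_lt_of_le (by positivity) hM
  have hN : 0 < K * l := Nat.mul_pos hK hl1
  have hNcast : ((K * l : ℕ) : ℝ) = K * l := by push_cast; ring
  have b₁ : B / ((K * l : ℕ) * δ ^ 2) ≤ 1 / 4 := by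
    rw [hNcast, div_le_iff₀ (by positivity)]
    linarith
  have b₂ : (2 : ℝ) ^ ((K * l : ℕ) * (c + δ)) / M ≤ 1 / 4 := by
    rw [div_le_iff₀ hMpos]
    have e : (2 : ℝ) ^ (l * R) = 2 ^ ((K * l : ℕ) * (c + δ)) * 2 ^ (l * ρ) := by
      rw [← Real.rpow_add two_pos, hNcast, hρ]
      congr 1
      ring
    have h4 : (4 : ℝ) ≤ 2 ^ (l * ρ) := by
      calc (4 : ℝ) = 2 ^ (2 : ℝ) := by norm_num
        _ ≤ _ := Real.rpow_le_rpow_of_exponent_le one_le_two hlρ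
    have h0 : (0 : ℝ) < 2 ^ ((K * l : ℕ) * (c + δ)) := by positivity
    nlinarith
  set T : ℝ := (2 : ℝ) ^ ((K * l : ℕ) * (E + δ)) with hT
  have hT0 : 0 < T := by positivity
  -- The tail and guessing terms are each at most `1 / 4`, which leaves at least `1 / 2` for the
  -- error term, for every `u`.
  have herr : 1 / 2 / T ≤ ε := by
    refine le_trans (code.le_eventProb W fun u => ?_) code.prob_error
    have := hB δ hδ (K * l) hN M (fun m n => code.enc n u m)
      (fun y => code.dec (code.τ u y) u (Fin.take (code.τ u y) (code.τ_le u y) y))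
      (by exact_mod_cast hMpos)
    rw [div_le_iff₀ hT0, mul_comm]
    linarith
  have hexp : (2 : ℝ) ^ (-1 - (K * l) * (E + δ)) ≤ 2 ^ (-(l * (E' - δ))) := by
    refine le_trans (le_of_eq ?_) (herr.trans hε)
    rw [Real.rpow_sub two_pos, hT, hNcast]
    norm_num
  rw [Real.rpow_le_rpow_left_iff one_lt_two] at hexp
  have : l * E' ≤ l * (K * E + (K + 2) * δ) := by linarith
  have := le_of_mul_le_mul_left this hl'
  linarith

lemma haroutunianExponent_eq_top {W : DMC X Y} {R : ℝ} (h : (R : EReal) < criticalRate W) :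
    haroutunianExponent W R = ⊤ := by
  refine iInf₂_eq_top.mpr fun V hV => ?_
  have hnot : ¬ ∀ x y, W x y = 0 → V x y = 0 := fun hVW =>
    absurd (iInf₂_le_of_le V hVW hV) (not_le.mpr h)
  push Not at hnot
  obtain ⟨x, y, hW, hV⟩ := hnot
  refine top_le_iff.mp (le_iSup_of_le x ?_)
  rw [klBits, if_pos ⟨y, hW, hV⟩]

/-- A competitor `V` may have capacity exactly `R / K`. Mixing in a little of `V₀`, and of `Q₀` into
`Q`, makes the output bound strict while keeping the divergence to `W` finite; the weight then tends
to zero. -/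
lemma AFLFAchievable.le_haroutunianExponent [Nonempty X] {W : DMC X Y} {R γ E' : ℝ} {K : ℕ}
    (hK : 1 ≤ K) (hR : criticalRate W < ((R / K : ℝ) : EReal)) (h : AFLFAchievable W γ K R E') :
    ((E' / K : ℝ) : EReal) ≤ haroutunianExponent W (R / K) := by
  have hK' : (0 : ℝ) < K := by exact_mod_cast hK
  obtain ⟨V₀, hV₀W, hV₀⟩ : ∃ V₀ : DMC X Y, (∀ x y, W x y = 0 → V₀ x y = 0) ∧
      capacity V₀ < ((R / K : ℝ) : EReal) := by
    simpa only [criticalRate, iInf_lt_iff, exists_prop] using hR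
  obtain ⟨c₀, hc₀, hc₀R⟩ := EReal.lt_iff_exists_real_btwn.mp hV₀
  rw [EReal.coe_lt_coe_iff] at hc₀R
  obtain ⟨Q₀, hQ₀, hVQ₀⟩ := exists_output_divLE hc₀.le
  obtain ⟨E₀, hE₀⟩ : ∃ E₀, DivLE V₀ W E₀ := by
    obtain ⟨E₀, hE₀⟩ := (Set.finite_range fun x => klSum (V₀ x) (W x)).bddAbove
    exact ⟨E₀, fun x => ⟨hV₀W x, hE₀ ⟨x, rfl⟩⟩⟩
  refine le_iInf₂ fun V hV => ?_
  obtain ⟨Q, hQ, hVQ⟩ := exists_output_divLE hV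
  refine EReal.le_of_forall_lt_iff_le.mp fun E hE => ?_
  rw [EReal.coe_le_coe_iff, div_le_iff₀ hK', mul_comm]
  have hVW := maxDiv_le_coe_iff.mp hE.le
  have hmix : ∀ t : ℝ, 0 < t → t < 1 → E' ≤ K * ((1 - t) * E + t * E₀) := by
    intro t h0 h1
    have hd := hVW.mix hE₀ h0 h1
    rw [DMC.mix_self] at hd
    refine h.le_of_divLE (Q := Q.mix Q₀ h0.le h1.le) ?_ hK hd (hVQ.mix hVQ₀ h0 h1) ?_
    · intro x x'
      simp only [DMC.mix, hQ x x', hQ₀ x x']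
    · nlinarith
  have hlim : Filter.Tendsto (fun t : ℝ => K * ((1 - t) * E + t * E₀))
      (nhdsWithin 0 (Set.Ioi 0)) (nhds (K * E)) := by
    have : ContinuousAt (fun t : ℝ => K * ((1 - t) * E + t * E₀)) 0 := by fun_prop
    have := this.tendsto.mono_left (nhdsWithin_le_nhds (s := Set.Ioi 0))
    simpa using this
  refine ge_of_tendsto hlim ?_
  filter_upwards [Ioo_mem_nhdsGT (zero_lt_one' ℝ)] with t ht
  exact hmix t ht.1 ht.2

lemma eAFLF_le_mul_haroutunianExponent [Nonempty X] (W : DMC X Y) {R γ : ℝ} {K : ℕ}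
    (hK : 1 ≤ K) (hR : ((R / K : ℝ) : EReal) ≠ criticalRate W) :
    eAFLF W R γ K ≤ (K : EReal) * haroutunianExponent W (R / K) := by
  have hK' : (0 : ℝ) < K := by exact_mod_cast hK
  have hKE : (0 : EReal) < (K : EReal) := by exact_mod_cast hK
  rcases hR.lt_or_gt with h | h
  · rw [haroutunianExponent_eq_top h, EReal.mul_top_of_pos hKE]
    exact le_top
  · refine iSup₂_le fun E hE => ?_
    have : (E : EReal) = (K : EReal) * ((E / K : ℝ) : EReal) := by
      rw [← EReal.coe_natCast, ← EReal.coe_mul, mul_div_cancel₀ _ hK'.ne']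
    rw [this]
    exact mul_le_mul_of_nonneg_left (hE.le_haroutunianExponent hK h) hKE.le

end Haroutunian

end FeedbackCoding

end

theorem mainTheorem4 {X Y : Type*} [Fintype X] [Fintype Y]
    (W : FeedbackCoding.DMC X Y) (R γ : ℝ) (K : ℕ)
    (hR : 0 ≤ R) (hRC : (R : EReal) < FeedbackCoding.capacity W)
    (hγ : 0 ≤ γ) (hK : 1 ≤ K) :
    FeedbackCoding.eAFLF W R γ K ≤ FeedbackCoding.eErasure W R γ ∧
    (((R / K : ℝ) : EReal) ≠ FeedbackCoding.criticalRate W →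
      FeedbackCoding.eAFLF W R γ K ≤
        min (FeedbackCoding.eErasure W R γ)
          ((K : EReal) * FeedbackCoding.haroutunianExponent W (R / K))) := by
  -- Without inputs the simplex is empty and the capacity is `⊥`, contradicting `hRC`.
  have hX : Nonempty X := by
    by_contra hX
    rw [not_nonempty_iff] at hX
    refine absurd hRC (not_lt.mpr (iSup₂_le fun P hP => ?_))
    simpa using hP.2
  have hY : Nonempty Y := by
    by_contra hY
    rw [not_nonempty_iff] at hY
    simpa using W.sum_one hX.some
  have h := FeedbackCoding.eAFLF_le_eErasure W R hγ hK
  exact ⟨h, fun hne => le_min h (FeedbackCoding.eAFLF_le_mul_haroutunianExponent W hK hne)⟩
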